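/- Let $G$ be a locally compact Hausdorff topological group with identity $1$. Then $G$ has a suitable set, that is, there is a subset $X \subseteq G$ such that (i) $X$ is discrete in the subspace topology, (ii) $X \cup \{1\}$ is closed in $G$, and (iii) the subgroup of $G$ generated by $X$ is dense in $G$. -/

import Mathlib

/-- A subset `X` of a topological group `G` is a suitable set for `G` if `X` is discrete (in the
subspace topology), `X ∪ {1}` is closed in `G`, and the subgroup generated by `X` is dense
in `G`. -/
structure IsSuitableSet {G : Type*} [Group G] [TopologicalSpace G] (X : Set G) : Prop where
  isDiscrete : IsDiscrete X
  isClosed_union_one : IsClosed (X ∪ {1})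
  dense_closure : Dense (Subgroup.closure X : Set G)

open Filter Topology Set
open scoped Pointwise
set_option linter.unusedSectionVars false

/-! ### Finiteness and word length in generated subgroups. -/

section Algebra

variable {G : Type*} [Group G]

/-! A compact symmetric neighbourhood of `1` generates an open subgroup `H`. Representatives of the
nontrivial cosets of `H` cannot accumulate, so it suffices to generate `H` topologically by a family
converging to `1`: `exists_isSuitableSet_of_open_subgroup`.

For compactly generated groups, `exists_tendsto_one_generating` applies Zorn's lemma to pairs of a
compact normal subgroup `N` and a family that converges to `N` and generates modulo `N`. Chains have
bounds by compactness (`exists_isSuitableModulo_of_directed`). If `1 ≠ g ∈ N`, a neighbourhood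
sequence avoiding `g` has a normal kernel `K`, and `IsSuitableModulo.exists_refinement` descends to
`N ⊓ K`: old terms move within their cosets of `N`, and new terms generate `N` modulo `N ⊓ K`. Hence
a maximal pair has `N = ⊥`. -/

theorem Subgroup.exists_finite_mem_closure_union {A S : Set G} {x : G}
    (hx : x ∈ Subgroup.closure (A ∪ S)) :
    ∃ B ⊆ S, B.Finite ∧ x ∈ Subgroup.closure (A ∪ B) := by
  induction hx using Subgroup.closure_induction with
  | mem x hx =>
    rcases hx with hx | hx
    · exact ⟨∅, empty_subset _, finite_empty, Subgroup.subset_closure (Or.inl hx)⟩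
    · exact ⟨{x}, by simpa using hx, finite_singleton x, Subgroup.subset_closure (Or.inr rfl)⟩
  | one => exact ⟨∅, empty_subset _, finite_empty, one_mem _⟩
  | mul x y _ _ hx hy =>
    obtain ⟨B, hBS, hB, hxB⟩ := hx
    obtain ⟨D, hDS, hD, hyD⟩ := hy
    refine ⟨B ∪ D, union_subset hBS hDS, hB.union hD, mul_mem ?_ ?_⟩
    · exact Subgroup.closure_mono (union_subset_union_right A subset_union_left) hxB
    · exact Subgroup.closure_mono (union_subset_union_right A subset_union_right) hyD
  | inv x _ hx =>
    obtain ⟨B, hBS, hB, hxB⟩ := hx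
    exact ⟨B, hBS, hB, inv_mem hxB⟩

theorem Subgroup.exists_finite_subset_closure_union {A S E : Set G} (hE : E.Finite)
    (hES : E ⊆ Subgroup.closure (A ∪ S)) :
    ∃ B ⊆ S, B.Finite ∧ E ⊆ Subgroup.closure (A ∪ B) := by
  choose! B hBS hB hxB using fun x (hx : x ∈ E) =>
    Subgroup.exists_finite_mem_closure_union (hES hx)
  refine ⟨⋃ x ∈ E, B x, iUnion₂_subset hBS, hE.biUnion hB, fun x hx => ?_⟩
  exact Subgroup.closure_mono (union_subset_union_right A (subset_biUnion_of_mem hx)) (hxB x hx)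

theorem Subgroup.exists_mem_pow_of_closure_eq {N : Subgroup G} {C : Set G} (hCinv : C⁻¹ = C)
    (hC : Subgroup.closure C = N) {x : G} (hx : x ∈ N) : ∃ n : ℕ, x ∈ C ^ n := by
  rw [← hC] at hx
  induction hx using Subgroup.closure_induction with
  | mem x hx => exact ⟨1, by simpa using hx⟩
  | one => exact ⟨0, by simp⟩
  | mul x y _ _ hx hy =>
    obtain ⟨m, hm⟩ := hx
    obtain ⟨n, hn⟩ := hy
    exact ⟨m + n, by rw [pow_add]; exact mul_mem_mul hm hn⟩
  | inv x _ hx =>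
    obtain ⟨m, hm⟩ := hx
    exact ⟨m, by rw [← hCinv, inv_pow]; simpa using hm⟩

end Algebra

/-! ### Neighbourhood sequences and their kernels. -/

section TopologicalGroup

variable {G : Type*} [Group G] [TopologicalSpace G] [IsTopologicalGroup G] [T2Space G]

theorem IsCompact.exists_finite_subset_mul {S V : Set G} (hS : IsCompact S) (hV : V ∈ 𝓝 (1 : G)) :
    ∃ T ⊆ S, T.Finite ∧ S ⊆ T * V := by
  obtain ⟨t, htS, ht⟩ := hS.elim_nhds_subcover (fun x => x • V)
    fun x _ => by simpa using smul_mem_nhds_smul x hV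
  refine ⟨t, htS, t.finite_toSet, fun x hx => ?_⟩
  obtain ⟨y, hy, hxy⟩ := mem_iUnion₂.1 (ht hx)
  obtain ⟨v, hv, rfl⟩ := hxy
  exact mul_mem_mul hy hv

/-- A decreasing sequence of compact neighbourhoods of `1` whose intersection is a subgroup
normalized by `C`. -/
structure IsNormalNhdsSeq (C : Set G) (W : ℕ → Set G) : Prop where
  mem_nhds : ∀ n, W n ∈ 𝓝 (1 : G)
  isCompact : ∀ n, IsCompact (W n)
  inv_eq : ∀ n, (W n)⁻¹ = W n
  mul_subset : ∀ n, W (n + 1) * W (n + 1) ⊆ W n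
  conj_mem : ∀ n, ∀ c ∈ C, ∀ x ∈ W (n + 1), c * x * c⁻¹ ∈ W n

theorem exists_smaller_compact_nhds [LocallyCompactSpace G] {C U : Set G} (hC : IsCompact C)
    (hU : U ∈ 𝓝 (1 : G)) : ∃ V ∈ 𝓝 (1 : G), IsCompact V ∧ V⁻¹ = V ∧ V * V ⊆ U ∧
      ∀ c ∈ C, ∀ x ∈ V, c * x * c⁻¹ ∈ U := by
  have hconj : ∀ᶠ x in 𝓝 (1 : G), ∀ c ∈ C, c * x * c⁻¹ ∈ U := by
    refine hC.eventually_forall_of_forall_eventually fun c _ => ?_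
    have h : Continuous fun z : G × G => z.2 * z.1 * z.2⁻¹ := by fun_prop
    have := h.tendsto (1, c)
    simp only [mul_one, mul_inv_cancel] at this
    exact this hU
  obtain ⟨O, hO, hOU⟩ := exists_nhds_one_split hU
  obtain ⟨V, hV, hVsub, hVc⟩ := local_compact_nhds (inter_mem hO hconj)
  refine ⟨V ∩ V⁻¹, inter_mem hV (inv_mem_nhds_one G hV), ?_, ?_, ?_, ?_⟩
  · exact hVc.inter_right (by simpa using hVc.inv.isClosed)
  · rw [inter_inv, inv_inv, inter_comm]
  · rintro _ ⟨a, ha, b, hb, rfl⟩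
    exact hOU a (hVsub ha.1).1 b (hVsub hb.1).1
  · exact fun c hc x hx => (hVsub hx.1).2 c hc

theorem exists_isNormalNhdsSeq [LocallyCompactSpace G] {C U : Set G} (hC : IsCompact C)
    (hU : U ∈ 𝓝 (1 : G)) : ∃ W : ℕ → Set G, IsNormalNhdsSeq C W ∧ W 0 ⊆ U := by
  choose! f hf hfc hfi hfm hfconj using
    fun (U : Set G) (hU : U ∈ 𝓝 (1 : G)) => exists_smaller_compact_nhds hC hU
  have hmem : ∀ n, f^[n] U ∈ 𝓝 (1 : G) := by
    intro n
    induction n with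
    | zero => exact hU
    | succ n ih => rw [Function.iterate_succ_apply']; exact hf _ ih
  refine ⟨fun n => f^[n + 1] U, ⟨fun n => hmem _, ?_, ?_, ?_, ?_⟩, ?_⟩
  · intro n; simp only [Function.iterate_succ_apply']; exact hfc _ (hmem n)
  · intro n; simp only [Function.iterate_succ_apply']; exact hfi _ (hmem n)
  · intro n; rw [Function.iterate_succ_apply' f (n + 1)]; exact hfm _ (hmem _)
  · intro n; rw [Function.iterate_succ_apply' f (n + 1)]; exact hfconj _ (hmem _)
  · intro x hx
    have := hfm U hU (mul_mem_mul hx (mem_of_mem_nhds (hf U hU)))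
    simpa using this

namespace IsNormalNhdsSeq

variable {C : Set G} {W : ℕ → Set G}

theorem one_mem (hW : IsNormalNhdsSeq C W) (n : ℕ) : (1 : G) ∈ W n :=
  mem_of_mem_nhds (hW.mem_nhds n)

theorem antitone (hW : IsNormalNhdsSeq C W) : Antitone W :=
  antitone_nat_of_succ_le fun n x hx => by
    simpa using hW.mul_subset n (mul_mem_mul hx (hW.one_mem (n + 1)))

/-- The intersection of the neighbourhoods, as a subgroup. -/
def kernel (hW : IsNormalNhdsSeq C W) : Subgroup G where
  carrier := ⋂ n, W n
  one_mem' := mem_iInter.2 hW.one_mem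
  mul_mem' := fun ha hb => mem_iInter.2 fun n =>
    hW.mul_subset n (mul_mem_mul (mem_iInter.1 ha (n + 1)) (mem_iInter.1 hb (n + 1)))
  inv_mem' := fun ha => mem_iInter.2 fun n => by
    rw [← hW.inv_eq n]
    simpa using mem_iInter.1 ha n

theorem mem_kernel (hW : IsNormalNhdsSeq C W) {x : G} : x ∈ hW.kernel ↔ ∀ n, x ∈ W n :=
  mem_iInter

theorem isCompact_kernel (hW : IsNormalNhdsSeq C W) :
    IsCompact (hW.kernel : Set G) :=
  (hW.isCompact 0).of_isClosed_subset (isClosed_iInter fun n => (hW.isCompact n).isClosed)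
    (iInter_subset W 0)

/-- Conjugation by an element of `C` costs one index, which the intersection absorbs; every `g` is a
finite product of such elements. -/
theorem kernel_normal (hW : IsNormalNhdsSeq C W) (hCinv : C⁻¹ = C)
    (hC : Subgroup.closure C = ⊤) : hW.kernel.Normal := by
  refine ⟨fun x hx g => ?_⟩
  have hg : g ∈ Subgroup.closure C := by rw [hC]; trivial
  have key : ∀ c ∈ C, ∀ x ∈ hW.kernel, c * x * c⁻¹ ∈ hW.kernel := fun c hc x hx =>
    hW.mem_kernel.2 fun n => hW.conj_mem n c hc x (hW.mem_kernel.1 hx (n + 1))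
  obtain ⟨n, hn⟩ := Subgroup.exists_mem_pow_of_closure_eq hCinv hC (Subgroup.mem_top g)
  clear hg
  induction n generalizing g x with
  | zero => simp at hn; simpa [hn] using hx
  | succ n ih =>
    rw [pow_succ] at hn
    obtain ⟨a, ha, b, hb, rfl⟩ := hn
    have := ih (b * x * b⁻¹) (key b hb x hx) a ha
    simpa [mul_assoc] using this

end IsNormalNhdsSeq

theorem IsCompact.pow {C : Set G} (hC : IsCompact C) (n : ℕ) : IsCompact (C ^ n) := by
  induction n with
  | zero => simp
  | succ n ih => rw [pow_succ]; exact ih.mul hC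

/-- The recurring compactness argument: corrections available at each stage yield one valid at all
stages. -/
theorem exists_forall_mem_mul_mem_of_directed {ι : Type*} [Nonempty ι] {t : ι → Set G}
    (ht : Directed (· ⊇ ·) t) (htc : ∀ i, IsCompact (t i)) {D : Set G} (hD : IsClosed D) (g : G)
    (h : ∀ i, ∃ k ∈ t i, g * k ∈ D) : ∃ k, (∀ i, k ∈ t i) ∧ g * k ∈ D := by
  have hcl : IsClosed {k | g * k ∈ D} := hD.preimage (continuous_const_mul g)
  obtain ⟨k, hk⟩ := IsCompact.nonempty_iInter_of_directed_nonempty_isCompact_isClosed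
    (fun i => t i ∩ {k | g * k ∈ D})
    (fun i j => (ht i j).imp fun l hl =>
      ⟨inter_subset_inter_left _ hl.1, inter_subset_inter_left _ hl.2⟩)
    (fun i => h i) (fun i => (htc i).inter_right hcl) (fun i => (htc i).isClosed.inter hcl)
  rw [mem_iInter] at hk
  exact ⟨k, fun i => (hk i).1, (hk (Classical.arbitrary ι)).2⟩

/-! ### Generators, lifts and convergence relative to a neighbourhood sequence. -/

namespace IsNormalNhdsSeq

variable {B C : Set G} {W : ℕ → Set G}

/-- A closed compactly generated subgroup is generated, topologically and modulo the kernel of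
`W`, by a set converging to the kernel. -/
theorem exists_generating (hW : IsNormalNhdsSeq B W) {N : Subgroup G}
    (hN : IsClosed (N : Set G)) (hCc : IsCompact C) (hC1 : (1 : G) ∈ C) (hCinv : C⁻¹ = C)
    (hC : Subgroup.closure C = N) : ∃ A ⊆ (N : Set G), (∀ n, (A \ W n).Finite) ∧
      N ≤ (Subgroup.closure A ⊔ (N ⊓ hW.kernel)).topologicalClosure := by
  have hCN : C ⊆ N := hC ▸ Subgroup.subset_closure
  have hWN : ∀ n, IsCompact (W n ∩ N) := fun n => (hW.isCompact n).inter_right hN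
  -- Two finite subsets of `W n ∩ N` are added: `T`, a net that allows `W n` to be replaced by `W (n
  -- + 1)`, and `F`, which helps generate a net `E` of `C ^ n` modulo `W n`. As all additions lie in
  -- `W n`, the union of the stages is finite outside each `W n`.
  have step : ∀ n (A : Set G), A.Finite → A ⊆ N → N ≤ Subgroup.closure (A ∪ (W n ∩ N)) →
      ∃ A' : Set G, A'.Finite ∧ A' ⊆ N ∧ N ≤ Subgroup.closure (A' ∪ (W (n + 1) ∩ N)) ∧ A ⊆ A' ∧
        A' \ A ⊆ W n ∧ C ^ n ⊆ (Subgroup.closure A' : Set G) * W n := by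
    intro n A hA hAN hgen
    obtain ⟨T, hTS, hT, hST⟩ := (hWN n).exists_finite_subset_mul (hW.mem_nhds (n + 1))
    obtain ⟨E, hEC, hE, hCE⟩ := (hCc.pow n).exists_finite_subset_mul (hW.mem_nhds n)
    obtain ⟨F, hFS, hF, hEF⟩ := Subgroup.exists_finite_subset_closure_union hE
      (((hEC.trans (Subgroup.pow_subset hCN)).trans hgen : E ⊆ _))
    refine ⟨A ∪ F ∪ T, (hA.union hF).union hT, ?_, ?_, ?_, ?_, ?_⟩
    · exact union_subset (union_subset hAN (hFS.trans inter_subset_right))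
        (hTS.trans inter_subset_right)
    · refine hgen.trans ((Subgroup.closure_le _).2 ?_)
      rintro x (hx | hx)
      · exact Subgroup.subset_closure (Or.inl (Or.inl (Or.inl hx)))
      · obtain ⟨a, ha, b, hb, rfl⟩ := hST hx
        have hbN : b ∈ N := by
          have := mul_mem (inv_mem (hTS ha).2) hx.2
          simpa using this
        exact mul_mem (Subgroup.subset_closure (Or.inl (Or.inr ha)))
          (Subgroup.subset_closure (Or.inr ⟨hb, hbN⟩))
    · exact subset_union_left.trans subset_union_left
    · rintro x ⟨(hx | hx) | hx, hxA⟩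
      · exact absurd hx hxA
      · exact (hFS hx).1
      · exact (hTS hx).1
    · refine hCE.trans (mul_subset_mul_right (hEF.trans ?_))
      exact Subgroup.closure_mono subset_union_left
  have start : ∃ A : Set G, A.Finite ∧ A ⊆ N ∧ N ≤ Subgroup.closure (A ∪ (W 0 ∩ N)) := by
    obtain ⟨T, hTS, hT, hST⟩ := hCc.exists_finite_subset_mul (hW.mem_nhds 0)
    refine ⟨T, hT, hTS.trans hCN, ?_⟩
    rw [← hC, Subgroup.closure_le, hC]
    intro x hx
    obtain ⟨a, ha, b, hb, rfl⟩ := hST hx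
    have hbN : b ∈ N := by
      have := mul_mem (inv_mem (hCN (hTS ha))) (hCN hx)
      simpa using this
    exact mul_mem (Subgroup.subset_closure (Or.inl ha)) (Subgroup.subset_closure (Or.inr ⟨hb, hbN⟩))
  choose! f hf hfN hfgen hfsub hfdiff hfC using step
  obtain ⟨A₀, hA₀, hA₀N, hA₀gen⟩ := start
  obtain ⟨A, hA0, hAs⟩ : ∃ A : ℕ → Set G, A 0 = A₀ ∧ ∀ n, A (n + 1) = f n (A n) :=
    ⟨fun n => Nat.rec A₀ f n, rfl, fun _ => rfl⟩
  have hA : ∀ n, (A n).Finite ∧ A n ⊆ N ∧ N ≤ Subgroup.closure (A n ∪ (W n ∩ N)) := by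
    intro n
    induction n with
    | zero => rw [hA0]; exact ⟨hA₀, hA₀N, hA₀gen⟩
    | succ n ih =>
      rw [hAs]
      exact ⟨hf n _ ih.1 ih.2.1 ih.2.2, hfN n _ ih.1 ih.2.1 ih.2.2, hfgen n _ ih.1 ih.2.1 ih.2.2⟩
  have hAdiff : ∀ n, A (n + 1) \ A n ⊆ W n := fun n =>
    hAs n ▸ hfdiff n _ (hA n).1 (hA n).2.1 (hA n).2.2
  have hAmono : Monotone A := monotone_nat_of_le_succ fun n =>
    hAs n ▸ hfsub n _ (hA n).1 (hA n).2.1 (hA n).2.2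
  have hAC : ∀ n, C ^ n ⊆ (Subgroup.closure (A (n + 1)) : Set G) * W n := fun n =>
    hAs n ▸ hfC n _ (hA n).1 (hA n).2.1 (hA n).2.2
  have hAN : ⋃ n, A n ⊆ N := iUnion_subset fun n => (hA n).2.1
  refine ⟨⋃ n, A n, hAN, fun n => ?_, fun g hg => ?_⟩
  · refine (hA n).1.subset ?_
    rintro x ⟨hx, hxW⟩
    obtain ⟨m, hm⟩ := mem_iUnion.1 hx
    induction m with
    | zero => exact hAmono (Nat.zero_le n) hm
    | succ m ih =>
      by_cases hxm : x ∈ A m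
      · exact ih hxm
      · rcases le_or_gt n m with h | h
        · exact absurd (hW.antitone h (hAdiff m ⟨hm, hxm⟩)) hxW
        · exact hAmono h hm
  · set D := (Subgroup.closure (⋃ n, A n) ⊔ (N ⊓ hW.kernel)).topologicalClosure
    have hle : Subgroup.closure (⋃ n, A n) ⊔ (N ⊓ hW.kernel) ≤ D :=
      Subgroup.le_topologicalClosure _
    have hclN : Subgroup.closure (⋃ n, A n) ≤ N := (Subgroup.closure_le _).2 hAN
    obtain ⟨p, hp⟩ := Subgroup.exists_mem_pow_of_closure_eq hCinv hC hg
    obtain ⟨k, hk, hgk⟩ := exists_forall_mem_mul_mem_of_directed (t := fun n => W n ∩ N)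
      (Antitone.directed_ge fun m n h => inter_subset_inter_left _ (hW.antitone h)) hWN
      (Subgroup.isClosed_topologicalClosure _ : IsClosed (D : Set G)) g (fun n => by
        -- The exponent must be at least `p` to reach `g` and at least `n` to have the error in `W
        -- n`.
        have hp' : g ∈ C ^ max n p := pow_subset_pow_right hC1 (le_max_right n p) hp
        obtain ⟨d, hd, w, hw, rfl⟩ := hAC _ hp'
        have hd' : d ∈ Subgroup.closure (⋃ n, A n) :=
          Subgroup.closure_mono (subset_iUnion A _) hd
        refine ⟨w⁻¹, ⟨?_, inv_mem ?_⟩, ?_⟩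
        · rw [← hW.inv_eq n]
          simpa using hW.antitone (le_max_left n p) hw
        · simpa using mul_mem (inv_mem (hclN hd')) hg
        · change d * w * w⁻¹ ∈ D
          rw [mul_inv_cancel_right]
          exact hle (le_sup_left (a := Subgroup.closure (⋃ n, A n)) hd'))
    have hkD : k ∈ D := hle (le_sup_right (a := Subgroup.closure (⋃ n, A n))
      ⟨(hk 0).2, hW.mem_kernel.2 fun n => (hk n).1⟩)
    simpa using mul_mem hgk (inv_mem hkD)

/-- Every element of `G` can be moved within its coset `x * N` as deep into the sequence `W` as
the coset permits. -/
theorem exists_lift (hW : IsNormalNhdsSeq B W) {N : Subgroup G} (hN : IsClosed (N : Set G))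
    (x : G) : ∃ b, x⁻¹ * b ∈ N ∧ (∀ n, x ∈ W n * (N : Set G) → b ∈ W n) ∧ (x ∈ N → b = 1) := by
  by_cases hx : x ∈ N
  · exact ⟨1, by simpa using hx, fun n _ => hW.one_mem n, fun _ => rfl⟩
  have hlift : ∀ n, x ∈ W n * (N : Set G) → ∃ b ∈ W n, x⁻¹ * b ∈ N := by
    rintro n ⟨w, hw, g, hg, rfl⟩
    exact ⟨w, hw, by simpa using hg⟩
  by_cases hall : ∀ n, x ∈ W n * (N : Set G)
  · obtain ⟨b, hb, hxb⟩ := exists_forall_mem_mul_mem_of_directed (t := W)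
      (Antitone.directed_ge hW.antitone) hW.isCompact hN x⁻¹ (fun n => hlift n (hall n))
    exact ⟨b, hxb, fun n _ => hb n, fun h => absurd h hx⟩
  · push Not at hall
    classical
    have hmin := fun m => Nat.find_min hall (m := m)
    have hlt : ∀ n, x ∈ W n * (N : Set G) → n < Nat.find hall := fun n hn => by
      by_contra! h
      exact Nat.find_spec hall (mul_subset_mul_right (hW.antitone h) hn)
    rcases Nat.eq_zero_or_pos (Nat.find hall) with h0 | h0
    -- The coset misses even `W 0`, so nothing is demanded; otherwise the last index before failure
    -- serves.
    · exact ⟨x, by simp, fun n hn => absurd (hlt n hn) (by omega), fun h => absurd h hx⟩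
    · obtain ⟨b, hb, hxb⟩ := hlift (Nat.find hall - 1) (not_not.1 (hmin _ (by omega)))
      exact ⟨b, hxb, fun n hn => hW.antitone (by have := hlt n hn; omega) hb,
        fun h => absurd h hx⟩

/-- A family that is eventually in each `W n` and converges to a closed set `S` converges to the
intersection of `S` with the kernel. -/
theorem tendsto_nhdsSet_inter_kernel (hW : IsNormalNhdsSeq B W) {S : Set G} (hS : IsClosed S)
    {α : Type*} {l : Filter α} {x : α → G} (hxW : ∀ n, ∀ᶠ a in l, x a ∈ W n)
    (hxS : Tendsto x l (𝓝ˢ S)) : Tendsto x l (𝓝ˢ (S ∩ hW.kernel)) := by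
  refine (hasBasis_nhdsSet _).tendsto_right_iff.2 ?_
  rintro O ⟨hO, hSO⟩
  by_contra hfreq
  rw [not_eventually] at hfreq
  -- A cluster point of `f` in the compact `W 0` would lie in `S` and in every `W n`, yet outside
  -- `O`.
  let f := map x l ⊓ 𝓟 Oᶜ
  have hf : f.NeBot := by
    rw [← frequently_mem_iff_neBot]
    exact frequently_map.2 hfreq
  have hfW : ∀ n, f ≤ 𝓟 (W n) := fun n => inf_le_left.trans (le_principal_iff.2 (hxW n))
  obtain ⟨y, -, hy⟩ := (hW.isCompact 0) (hfW 0)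
  have hyW : ∀ n, y ∈ W n := fun n =>
    isClosed_iff_clusterPt.1 (hW.isCompact n).isClosed y (hy.mono (hfW n))
  have hyS : y ∈ S := by
    by_contra h
    rw [← hS.closure_eq, ← disjoint_nhdsSet_nhds] at h
    exact hy.ne (le_bot_iff.1 (h.symm.le_bot.trans' (inf_le_inf_left _ (inf_le_left.trans hxS))))
  have hyO : y ∈ Oᶜ := isClosed_iff_clusterPt.1 hO.isClosed_compl y (hy.mono inf_le_right)
  exact hyO (hSO ⟨hyS, hW.mem_kernel.2 hyW⟩)

end IsNormalNhdsSeq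

/-! ### Families suitable modulo a normal subgroup, and the Zorn argument. -/

theorem Subgroup.tendsto_nhdsSet_of_inv_mul_mem {N : Subgroup G} (hN : IsCompact (N : Set G))
    {α : Type*} {l : Filter α} {x y : α → G} (hx : Tendsto x l (𝓝ˢ N))
    (hxy : ∀ a, (x a)⁻¹ * y a ∈ N) : Tendsto y l (𝓝ˢ N) := by
  refine (hasBasis_nhdsSet _).tendsto_right_iff.2 ?_
  rintro O ⟨hO, hNO⟩
  obtain ⟨V, hV, hVO⟩ := compact_open_separated_mul_left hN hO hNO
  have hVN : V * (N : Set G) ∈ 𝓝ˢ (N : Set G) := by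
    refine mem_nhdsSet_iff_forall.2 fun g hg => ?_
    have h := smul_mem_nhds_smul (MulOpposite.op g) hV
    refine mem_of_superset (by simpa using h) ?_
    rintro _ ⟨v, hv, rfl⟩
    exact mul_mem_mul hv hg
  filter_upwards [hx hVN] with a ha
  obtain ⟨v, hv, g, hg, hvg⟩ := ha
  refine hVO ⟨v, hv, g * ((x a)⁻¹ * y a), mul_mem hg (hxy a), ?_⟩
  simp only at hvg ⊢
  rw [← mul_assoc, hvg, mul_inv_cancel_left]

/-- The family `x` converges to `1` and generates `G` topologically, both modulo the normal
subgroup `N`; only the indices attached to subgroups above `N` are in use. -/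
structure IsSuitableModulo (N : Subgroup G) (x : Subgroup G × G → G) : Prop where
  normal : N.Normal
  tendsto : Tendsto x cofinite (𝓝ˢ N)
  dense : (Subgroup.closure (range x) ⊔ N).topologicalClosure = ⊤
  mem_of_not_lt : ∀ L g, ¬ N < L → x (L, g) ∈ N

theorem isSuitableModulo_top : IsSuitableModulo (⊤ : Subgroup G) fun _ => 1 where
  normal := inferInstance
  tendsto := by simp
  dense := top_le_iff.1 (le_sup_right.trans (Subgroup.le_topologicalClosure _))
  mem_of_not_lt := fun _ _ _ => trivial

theorem IsSuitableModulo.exists_refinement [LocallyCompactSpace G] {C : Set G}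
    (hCc : IsCompact C) (hC1 : (1 : G) ∈ C) (hCinv : C⁻¹ = C) (hC : Subgroup.closure C = ⊤)
    {N : Subgroup G} {x : Subgroup G × G → G} (hx : IsSuitableModulo N x)
    (hN : IsCompact (N : Set G) ∨ N = ⊤) {g : G} (hg : g ≠ 1) :
    ∃ N' x', IsSuitableModulo N' x' ∧ IsCompact (N' : Set G) ∧ N' ≤ N ∧ g ∉ N' ∧
      ∀ a, (x a)⁻¹ * x' a ∈ N := by
  classical
  obtain ⟨W, hW, hW0⟩ := exists_isNormalNhdsSeq hCc
    (isOpen_compl_singleton.mem_nhds (Ne.symm hg) : ({g}ᶜ : Set G) ∈ 𝓝 1)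
  have hNcl : IsClosed (N : Set G) := by
    rcases hN with hN | rfl
    · exact hN.isClosed
    · exact isClosed_univ
  obtain ⟨A, hAN, hAfin, hAgen⟩ : ∃ A ⊆ (N : Set G), (∀ n, (A \ W n).Finite) ∧
      N ≤ (Subgroup.closure A ⊔ (N ⊓ hW.kernel)).topologicalClosure := by
    -- A compact `N` is its own compact generating set; for `N = ⊤` the set `C` is used.
    rcases hN with hN | rfl
    · exact hW.exists_generating hNcl hN (one_mem N) (by simp) (Subgroup.closure_eq N)
    · exact hW.exists_generating hNcl hCc hC1 hCinv hC
  choose b hxb hbW hb1 using hW.exists_lift hNcl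
  -- The slots `(N, h)` hold only elements of `N` so far, so the new generators fit there without
  -- leaving the cosets of `N`. Other terms already in `N` are sent to `1` by `hb1`, which keeps
  -- unused slots in the smaller subgroup.
  let x' : Subgroup G × G → G := fun a =>
    if a.1 = N then (if a.2 ∈ A then a.2 else 1) else b (x a)
  have hx'N : ∀ h, x' (N, h) ∈ N := fun h => by
    by_cases hA : h ∈ A
    · simpa [x', hA] using hAN hA
    · simp [x', hA]
  have hxx' : ∀ a, (x a)⁻¹ * x' a ∈ N := by
    rintro ⟨L, h⟩
    by_cases hL : L = N
    · subst hL
      exact mul_mem (inv_mem (hx.mem_of_not_lt _ _ (lt_irrefl _))) (hx'N h)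
    · simpa [x', hL] using hxb (x (L, h))
  have hK : (N ⊓ hW.kernel) ≤ N := inf_le_left
  have hnK := hW.kernel_normal hCinv hC
  have hnN := hx.normal
  refine ⟨N ⊓ hW.kernel, x', ⟨inferInstance, ?_, ?_, ?_⟩, ?_, hK, ?_, hxx'⟩
  · rw [Subgroup.coe_inf]
    refine hW.tendsto_nhdsSet_inter_kernel hNcl (fun n => ?_) ?_
    · have hWN : W n * (N : Set G) ∈ 𝓝ˢ (N : Set G) := by
        refine mem_nhdsSet_iff_forall.2 fun k hk => ?_
        refine mem_of_superset
          (by simpa using smul_mem_nhds_smul (MulOpposite.op k) (hW.mem_nhds n)) ?_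
        rintro _ ⟨v, hv, rfl⟩
        exact mul_mem_mul hv hk
      have h1 : ∀ᶠ a in cofinite, a ∉ Prod.mk N '' (A \ W n) :=
        ((hAfin n).image _).eventually_cofinite_notMem
      filter_upwards [hx.tendsto hWN, h1] with a ha ha'
      obtain ⟨L, h⟩ := a
      by_cases hL : L = N
      · subst hL
        by_cases hA : h ∈ A
        · have : h ∈ W n := by
            by_contra hh
            exact ha' ⟨h, ⟨hA, hh⟩, rfl⟩
          simpa [x', hA] using this
        · simpa [x', hA] using hW.one_mem n
      · simpa [x', hL] using hbW _ n ha
    · rcases hN with hN | rfl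
      · exact Subgroup.tendsto_nhdsSet_of_inv_mul_mem hN hx.tendsto hxx'
      · simp
  · set D := (Subgroup.closure (range x') ⊔ (N ⊓ hW.kernel)).topologicalClosure
    have hle : Subgroup.closure (range x') ⊔ (N ⊓ hW.kernel) ≤ D :=
      Subgroup.le_topologicalClosure _
    have hND : N ≤ D := by
      refine hAgen.trans (Subgroup.topologicalClosure_mono (sup_le_sup_right ?_ _))
      refine Subgroup.closure_mono fun h hA => ⟨(N, h), ?_⟩
      simp [x', hA]
    rw [← top_le_iff, ← hx.dense]
    refine Subgroup.topologicalClosure_minimal _ (sup_le ?_ hND)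
      (Subgroup.isClosed_topologicalClosure _)
    rw [Subgroup.closure_le]
    rintro _ ⟨a, rfl⟩
    have h1 : x' a ∈ D := hle (le_sup_left (a := Subgroup.closure (range x'))
      (Subgroup.subset_closure (mem_range_self a)))
    simpa using mul_mem h1 (inv_mem (hND (hxx' a)))
  · intro L h hL
    by_cases hLN : L = N
    · subst hLN
      rw [hK.eq_of_not_lt hL]
      exact hx'N h
    · have := hb1 _ (hx.mem_of_not_lt L h fun hlt => hL (hK.trans_lt hlt))
      simp [x', hLN, this]
  · rw [Subgroup.coe_inf]
    exact hW.isCompact_kernel.inter_left hNcl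
  · exact fun h => hW0 (hW.mem_kernel.1 h.2 0) rfl

/-- For each index `a` the compact cosets `x i a • N i` are directed downwards, so they share a
point, taken as `x' a`. Convergence holds because any open set containing `iInf N` contains some `N
i`. -/
theorem exists_isSuitableModulo_of_directed {ι : Type*} [Nonempty ι] {N : ι → Subgroup G}
    {x : ι → Subgroup G × G → G} (hx : ∀ i, IsSuitableModulo (N i) (x i))
    (hN : ∀ i, IsCompact (N i : Set G))
    (hdir : Directed (fun i j => N j ≤ N i ∧ ∀ a, (x i a)⁻¹ * x j a ∈ N i) id) :
    ∃ N' x', IsSuitableModulo N' x' ∧ IsCompact (N' : Set G) ∧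
      ∀ i, N' ≤ N i ∧ ∀ a, (x i a)⁻¹ * x' a ∈ N i := by
  have hNdir : Directed (· ⊇ ·) fun i => (N i : Set G) := fun i j =>
    (hdir i j).imp fun k hk => ⟨hk.1.1, hk.2.1⟩
  have hlim : ∀ a, ∃ y, ∀ i, (x i a)⁻¹ * y ∈ N i := fun a => by
    have hc : ∀ i, IsCompact (x i a • (N i : Set G)) := fun i => (hN i).smul _
    obtain ⟨y, hy⟩ := IsCompact.nonempty_iInter_of_directed_nonempty_isCompact_isClosed
      (fun i => x i a • (N i : Set G)) (fun i j => by
        refine (hdir i j).imp fun k hk => ⟨?_, ?_⟩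
        · rintro _ ⟨n, hn, rfl⟩
          refine mem_smul_set_iff_inv_smul_mem.2 ?_
          simpa [mul_assoc] using mul_mem (hk.1.2 a) (hk.1.1 hn)
        · rintro _ ⟨n, hn, rfl⟩
          refine mem_smul_set_iff_inv_smul_mem.2 ?_
          simpa [mul_assoc] using mul_mem (hk.2.2 a) (hk.2.1 hn))
      (fun i => ⟨_, smul_mem_smul_set (one_mem (N i))⟩) hc (fun i => (hc i).isClosed)
    exact ⟨y, fun i => by simpa [mem_smul_set_iff_inv_smul_mem] using mem_iInter.1 hy i⟩
  choose x' hx' using hlim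
  have hle : ∀ i, iInf N ≤ N i := iInf_le N
  have hNc : IsCompact ((iInf N : Subgroup G) : Set G) := by
    rw [Subgroup.coe_iInf]
    exact (hN (Classical.arbitrary ι)).of_isClosed_subset
      (isClosed_iInter fun i => (hN i).isClosed) (iInter_subset _ _)
  refine ⟨iInf N, x', ⟨Subgroup.normal_iInf_normal fun i => (hx i).normal, ?_, ?_, ?_⟩, hNc,
    fun i => ⟨hle i, fun a => hx' a i⟩⟩
  · refine (hasBasis_nhdsSet _).tendsto_right_iff.2 ?_
    rintro O ⟨hO, hNO⟩
    rw [Subgroup.coe_iInf] at hNO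
    obtain ⟨i, hi⟩ := exists_subset_nhds_of_isCompact' hNdir hN (fun i => (hN i).isClosed)
      fun y hy => hO.mem_nhds (hNO hy)
    exact Subgroup.tendsto_nhdsSet_of_inv_mul_mem (hN i) (hx i).tendsto (fun a => hx' a i)
      (hO.mem_nhdsSet.2 hi)
  · set D := (Subgroup.closure (range x') ⊔ iInf N).topologicalClosure
    have hleD : Subgroup.closure (range x') ⊔ iInf N ≤ D := Subgroup.le_topologicalClosure _
    have hDcl : IsClosed (D : Set G) := Subgroup.isClosed_topologicalClosure _
    rw [← top_le_iff]
    intro g _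
    -- The product of the closed `D` with the compact normal `N i` is a closed subgroup, and it
    -- contains every `x i a`.
    have hDN : ∀ i, g ∈ (D : Set G) * (N i : Set G) := fun i => by
      have := (hx i).normal
      have hsup : (D ⊔ N i : Subgroup G) = ⊤ := by
        rw [← top_le_iff, ← (hx i).dense]
        refine Subgroup.topologicalClosure_minimal _ (sup_le ?_ le_sup_right) ?_
        · rw [Subgroup.closure_le]
          rintro _ ⟨a, rfl⟩
          have h1 : x' a ∈ D ⊔ N i := le_sup_left (a := D) (hleD
            (le_sup_left (a := Subgroup.closure (range x'))
              (Subgroup.subset_closure (mem_range_self a))))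
          simpa using mul_mem h1 (inv_mem (le_sup_right (a := D) (hx' a i)))
        · rw [Subgroup.mul_normal]
          exact hDcl.mul_right_of_isCompact (hN i)
      rw [← Subgroup.mul_normal, hsup]
      trivial
    obtain ⟨k, hk, hgk⟩ := exists_forall_mem_mul_mem_of_directed hNdir hN hDcl g fun i => by
      obtain ⟨d, hd, n, hn, rfl⟩ := hDN i
      exact ⟨n⁻¹, inv_mem hn, by simpa only [mul_inv_cancel_right] using hd⟩
    have hkD : k ∈ D := hleD (le_sup_right (a := Subgroup.closure (range x'))
      (Subgroup.mem_iInf.2 hk))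
    simpa using mul_mem hgk (inv_mem hkD)
  · intro L h hL
    refine Subgroup.mem_iInf.2 fun i => ?_
    have := (hx i).mem_of_not_lt L h fun hlt => hL ((hle i).trans_lt hlt)
    simpa using mul_mem this (hx' (L, h) i)

theorem exists_tendsto_one_generating [LocallyCompactSpace G] {C : Set G}
    (hCc : IsCompact C) (hC1 : (1 : G) ∈ C) (hCinv : C⁻¹ = C) (hC : Subgroup.closure C = ⊤) :
    ∃ x : Subgroup G × G → G, Tendsto x cofinite (𝓝 1) ∧
      Dense (Subgroup.closure (range x) : Set G) := by
  rcases subsingleton_or_nontrivial G with hG | hG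
  · exact ⟨fun _ => 1, tendsto_const_nhds, fun g => subset_closure (by
      rw [Subsingleton.elim g 1]; exact one_mem _)⟩
  let P := {p : Subgroup G × (Subgroup G × G → G) //
    IsSuitableModulo p.1 p.2 ∧ IsCompact (p.1 : Set G)}
  let r : P → P → Prop := fun p q =>
    q.1.1 ≤ p.1.1 ∧ ∀ a, (p.1.2 a)⁻¹ * q.1.2 a ∈ p.1.1
  have hrefl : ∀ p, r p p := fun p => ⟨le_rfl, fun a => by simp⟩
  -- Since `⊤` need not be compact, one refinement is needed to make `P` nonempty.
  obtain ⟨g₀, hg₀⟩ := exists_ne (1 : G)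
  obtain ⟨N₀, x₀, hx₀, hN₀, -⟩ :=
    isSuitableModulo_top.exists_refinement hCc hC1 hCinv hC (Or.inr rfl) hg₀
  have : Nonempty P := ⟨⟨(N₀, x₀), hx₀, hN₀⟩⟩
  obtain ⟨⟨⟨N, x⟩, hx, hN⟩, hmax⟩ := exists_maximal_of_nonempty_chains_bounded (r := r)
    (fun c hc hne => by
      have : Nonempty c := hne.to_subtype
      obtain ⟨N', x', hx', hN', h⟩ := exists_isSuitableModulo_of_directed
        (N := fun i : c => i.1.1.1) (x := fun i : c => i.1.1.2) (fun i => i.1.2.1)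
        (fun i => i.1.2.2) (fun i j => by
          have : Std.Refl r := ⟨hrefl⟩
          rcases hc.total i.2 j.2 with hij | hji
          · exact ⟨j, hij, hrefl j⟩
          · exact ⟨i, hrefl i, hji⟩)
      exact ⟨⟨(N', x'), hx', hN'⟩, fun p hp => h ⟨p, hp⟩⟩)
    (fun {p q s} hpq hqs => ⟨hqs.1.trans hpq.1, fun a => by
      simpa [mul_assoc] using mul_mem (hpq.2 a) (hpq.1 (hqs.2 a))⟩)
  have hbot : N = ⊥ := by
    rw [Subgroup.eq_bot_iff_forall]
    intro g hgN
    by_contra hg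
    obtain ⟨N', x', hx', hN', hle, hgN', hxx'⟩ :=
      hx.exists_refinement hCc hC1 hCinv hC (Or.inl hN) hg
    exact hgN' ((hmax ⟨(N', x'), hx', hN'⟩ ⟨hle, hxx'⟩).1 hgN)
  subst hbot
  refine ⟨x, by simpa using hx.tendsto, ?_⟩
  have := congrArg (fun H : Subgroup G => (H : Set G)) hx.dense
  simpa [dense_iff_closure_eq] using this

end TopologicalGroup

/-! ### From an open subgroup to the whole group. -/

theorem isSuitableSet_of_locallyFinite {G : Type*} [Group G] [TopologicalSpace G] [T1Space G]
    {X : Set G} (h1 : (1 : G) ∉ X) (hX : ∀ x ≠ 1, ∃ U ∈ 𝓝 x, (U ∩ X).Finite)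
    (hdense : Dense (Subgroup.closure X : Set G)) : IsSuitableSet X where
  isDiscrete := by
    refine isDiscrete_iff_nhdsWithin.2 fun x hx => ?_
    obtain ⟨U, hU, hfin⟩ := hX x fun h => h1 (h ▸ hx)
    refine le_antisymm ?_ (pure_le_nhdsWithin hx)
    have hV : ((U ∩ X) \ {x})ᶜ ∈ 𝓝 x := (hfin.sdiff).isClosed.isOpen_compl.mem_nhds (by simp)
    rw [le_pure_iff]
    filter_upwards [mem_nhdsWithin_of_mem_nhds hU, mem_nhdsWithin_of_mem_nhds hV,
      self_mem_nhdsWithin] with y hyU hyV hyX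
    by_contra hy
    exact hyV ⟨⟨hyU, hyX⟩, hy⟩
  isClosed_union_one := by
    refine isOpen_compl_iff.1 (isOpen_iff_mem_nhds.2 fun x hx => ?_)
    have hx1 : x ≠ 1 := fun h => hx (Or.inr h)
    obtain ⟨U, hU, hfin⟩ := hX x hx1
    have hV : (U ∩ X)ᶜ ∈ 𝓝 x :=
      hfin.isClosed.isOpen_compl.mem_nhds fun h => hx (Or.inl h.2)
    filter_upwards [hU, hV, isOpen_compl_singleton.mem_nhds hx1] with y hyU hyV hy1
    rintro (hy | hy)
    · exact hyV ⟨hyU, hy⟩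
    · exact hy1 hy
  dense_closure := hdense

theorem exists_isSuitableSet_of_open_subgroup {G : Type*} [Group G] [TopologicalSpace G]
    [IsTopologicalGroup G] [T2Space G] {H : Subgroup G} (hH : IsOpen (H : Set G)) {J : Type*}
    {x : J → H} (hx : Tendsto x cofinite (𝓝 1))
    (hdense : Dense (Subgroup.closure (range x) : Set H)) : ∃ X : Set G, IsSuitableSet X := by
  let y : J → G := fun a => x a
  let R : Set G := {g | ∃ q : G ⧸ H, q ≠ ((1 : G) : G ⧸ H) ∧ q.out = g}
  have hRH : ∀ g ∈ R, g ∉ H := by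
    rintro _ ⟨q, hq, rfl⟩ hqH
    refine hq ?_
    rw [← QuotientGroup.out_eq' q]
    exact (QuotientGroup.eq.2 (by simpa using hqH))
  have hyt : Tendsto y cofinite (𝓝 1) :=
    (continuous_subtype_val.tendsto (1 : H)).comp hx
  refine ⟨(range y \ {1}) ∪ R, isSuitableSet_of_locallyFinite ?_ ?_ ?_⟩
  · rintro (h | h)
    · exact h.2 rfl
    · exact hRH 1 h (one_mem H)
  · intro g hg
    by_cases hgH : g ∈ H
    · obtain ⟨U, V, hU, hV, hgU, h1V, hUV⟩ := t2_separation hg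
      refine ⟨U ∩ H, inter_mem (hU.mem_nhds hgU) (hH.mem_nhds hgH), ?_⟩
      have hfin : {a | y a ∉ V}.Finite := hyt (hV.mem_nhds h1V)
      refine (hfin.image y).subset ?_
      rintro z ⟨⟨hzU, hzH⟩, (⟨⟨a, rfl⟩, -⟩ | hz)⟩
      · exact ⟨a, fun h => hUV.le_bot ⟨hzU, h⟩, rfl⟩
      · exact absurd hzH (hRH z hz)
    -- The open coset of `g` misses `H`, hence `range y`, and contains just one chosen
    -- representative.
    · refine ⟨g • (H : Set G), (hH.smul g).mem_nhds ⟨1, one_mem H, by simp⟩, ?_⟩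
      refine (finite_singleton (g : G ⧸ H).out).subset ?_
      rintro z ⟨hzg, hz⟩
      rw [mem_smul_set_iff_inv_smul_mem, smul_eq_mul] at hzg
      rcases hz with ⟨⟨a, rfl⟩, -⟩ | ⟨q, hq, rfl⟩
      · refine absurd ?_ hgH
        simpa [y] using mul_mem (x a).2 (inv_mem hzg)
      · have : (g : G ⧸ H) = q := by
          rw [← QuotientGroup.out_eq' q]
          exact QuotientGroup.eq.2 hzg
        simp [this]
  · set X := (range y \ {1}) ∪ R
    set D := (Subgroup.closure X).topologicalClosure
    have hXD : Subgroup.closure X ≤ D := Subgroup.le_topologicalClosure _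
    have hHD : H ≤ D := by
      have hcl : IsClosed {h : H | (h : G) ∈ D} :=
        (Subgroup.isClosed_topologicalClosure _).preimage continuous_subtype_val
      have hsub : (Subgroup.closure (range x) : Set H) ⊆ {h : H | (h : G) ∈ D} := by
        refine (Subgroup.closure_le (D.comap H.subtype)).2 ?_
        rintro _ ⟨a, rfl⟩
        by_cases h1 : y a = 1
        · change y a ∈ D
          rw [h1]
          exact one_mem D
        · exact hXD (Subgroup.subset_closure (Or.inl ⟨mem_range_self a, h1⟩))
      intro h hh
      exact closure_minimal hsub hcl (hdense ⟨h, hh⟩)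
    intro g
    change g ∈ D
    by_cases hgH : g ∈ H
    · exact hHD hgH
    · have hq : (g : G ⧸ H).out ∈ D := hXD (Subgroup.subset_closure (Or.inr
        ⟨_, fun h => hgH (by simpa using QuotientGroup.eq.1 h.symm), rfl⟩))
      have hg : (g : G ⧸ H).out⁻¹ * g ∈ H :=
        QuotientGroup.eq.1 (QuotientGroup.out_eq' (g : G ⧸ H))
      simpa using mul_mem hq (hHD hg)

theorem theorem1p1 {G : Type*} [Group G] [TopologicalSpace G] [IsTopologicalGroup G]
    [T2Space G] [LocallyCompactSpace G] : ∃ X : Set G, IsSuitableSet X := by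
  obtain ⟨B, hBc, hB⟩ := exists_compact_mem_nhds (1 : G)
  obtain ⟨C, hCc, hC, hCinv⟩ : ∃ C : Set G, IsCompact C ∧ C ∈ 𝓝 (1 : G) ∧ C⁻¹ = C :=
    ⟨B ∪ B⁻¹, hBc.union hBc.inv, mem_of_superset hB subset_union_left, by simp [union_comm]⟩
  have hC1 : (1 : G) ∈ C := mem_of_mem_nhds hC
  have hHo : IsOpen (Subgroup.closure C : Set G) :=
    Subgroup.isOpen_of_mem_nhds _ (mem_of_superset hC Subgroup.subset_closure)
  have hHc : IsClosed (Subgroup.closure C : Set G) := Subgroup.isClosed_of_isOpen _ hHo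
  have : LocallyCompactSpace (Subgroup.closure C) := hHo.locallyCompactSpace
  have hinv : ((↑) ⁻¹' C : Set (Subgroup.closure C))⁻¹ = (↑) ⁻¹' C := by
    ext h
    rw [Set.mem_inv, mem_preimage, mem_preimage, Subgroup.coe_inv, ← Set.mem_inv, hCinv]
  have hC' : IsCompact ((↑) ⁻¹' C : Set (Subgroup.closure C)) :=
    hHc.isClosedEmbedding_subtypeVal.isCompact_preimage hCc
  obtain ⟨x, hx, hdense⟩ := exists_tendsto_one_generating hC' hC1 hinv
    Subgroup.closure_closure_coe_preimage
  exact exists_isSuitableSet_of_open_subgroup hHo hx hdense
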